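/- For nonnegative integers $n$ and $m$, an $m$-modular Hadamard matrix of size $n$, written $MH(n,m)$, is an $n \times n$ matrix $H$ with all entries $\pm 1$ such that $HH^\top \equiv nI \pmod m$ entrywise. Theorem (Hadamard conjecture modulo 7 for large $n$). For every integer $n \ge 4.5 \times 10^{36}$, an $MH(n,7)$ exists if and only if $n$ is even or $n$ is a quadratic residue modulo $7$, where the class of $0$ counts as a quadratic residue (that is, $n \equiv x^2 \pmod 7$ for some integer $x$). -/

import Mathlib

/-- `H` is an `m`-modular Hadamard matrix of size `n`, an `MH(n, m)`: an `n × n` matrix with entries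
`±1` such that `H Hᵀ ≡ n I (mod m)` entrywise. -/
def IsModularHadamard (n m : ℕ) (H : Matrix (Fin n) (Fin n) ℤ) : Prop :=
  (∀ i j, H i j = 1 ∨ H i j = -1) ∧
    ∀ i j, (H * H.transpose) i j ≡ ((n : ℤ) • (1 : Matrix (Fin n) (Fin n) ℤ)) i j [ZMOD (m : ℤ)]

/-!
If `n` is odd and `H` is an `MH(n, 7)`, then `det(H)² = nⁿ` in `ZMod 7`, so `n` is a square there
(`isSquare_of_hasMH`).

Conversely, partition the index set into classes, and let the block of rows in class `a` and columns
in class `c` be `± (J - 2 A)`, where `J` is the all-ones block and `A` is a `0`-`1` block with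
constant row sums modulo `7`. Off the diagonal `A` is `0` or, when the two classes have the same size
`m`, possibly the identity; on the diagonal it may also be the incidence matrix of a symmetric design
modulo `7`. The inner product of two rows then depends only on the class sizes modulo `7`, on the
signs and on the parameters of the blocks `A`, so that a finite table of signs decides
orthogonality (`hasMH_of_blocks`).

A scheme (`IsScheme`) is such a table with `r` classes of one common free size `m` and finitely many
classes of fixed size. Since only `m` modulo `7` matters, a single scheme yields matrices for all
large `n` in one residue class modulo `7 r`. The `r` free classes need a weighing matrix (modulo `7`)
of order `r` and weight `k` with `4 k = n` in `ZMod 7`: for non-squares `n` this makes `r` even, and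
orders `4` and `8` suffice. The fixed classes are points, projective planes, Paley designs, a
`(36, 15, 6)` design and a `(25, 9, 3)` design; they adjust `n` modulo `r`.

Together with `J` for `n = 0`, `J - 2 I` for `n = 4`, and Sylvester doubling `n ↦ 2 n`
(`HasMH.two_mul`), the schemes cover every large `n` which is even or a square modulo `7`.
-/

/-! ### Modular Hadamard matrices, necessity and doubling -/

/-- There is a `7`-modular Hadamard matrix of size `n`. -/
def HasMH (n : ℕ) : Prop := ∃ H : Matrix (Fin n) (Fin n) ℤ, IsModularHadamard n 7 H

/-- Only orthogonality modulo `7` of distinct rows has to be checked: the inner product of a row with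
itself is the size. -/
theorem hasMH_of_fintype {ι : Type*} [Fintype ι] (H : ι → ι → ℤ)
    (h1 : ∀ i j, H i j = 1 ∨ H i j = -1)
    (h2 : ∀ i j, i ≠ j → ((∑ k, H i k * H j k : ℤ) : ZMod 7) = 0) :
    HasMH (Fintype.card ι) := by
  classical
  let f := Fintype.equivFin ι
  let M : Matrix (Fin (Fintype.card ι)) (Fin (Fintype.card ι)) ℤ :=
    Matrix.of fun i j => H (f.symm i) (f.symm j)
  refine ⟨M, fun i j => h1 _ _, fun i j => ?_⟩
  have hsum : (M * M.transpose) i j = ∑ k, H (f.symm i) k * H (f.symm j) k := by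
    rw [Matrix.mul_apply]
    exact Equiv.sum_comp f.symm (fun k => H (f.symm i) k * H (f.symm j) k)
  rw [hsum]
  rcases eq_or_ne i j with rfl | hij
  · have hsq : ∀ k, H (f.symm i) k * H (f.symm i) k = 1 := fun k => by
      rcases h1 (f.symm i) k with h | h <;> rw [h] <;> norm_num
    simp [hsq, Int.ModEq.refl]
  · have := h2 _ _ (f.symm.injective.ne hij)
    rw [ZMod.intCast_zmod_eq_zero_iff_dvd] at this
    simpa [hij] using (Int.modEq_zero_iff_dvd.2 this)

theorem IsModularHadamard.sum_eq_zero {n : ℕ} {H : Matrix (Fin n) (Fin n) ℤ}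
    (hH : IsModularHadamard n 7 H) {i j : Fin n} (hij : i ≠ j) : ((∑ k, H i k * H j k : ℤ) : ZMod 7) = 0 := by
  have := hH.2 i j
  rw [ZMod.intCast_zmod_eq_zero_iff_dvd, ← Int.modEq_zero_iff_dvd]
  simpa [Matrix.mul_apply, hij] using this

/-- Sylvester doubling: the Kronecker product with the Hadamard matrix of order `2`. -/
theorem HasMH.two_mul {n : ℕ} (h : HasMH n) : HasMH (2 * n) := by
  obtain ⟨H, hH⟩ := h
  let s : Bool → Bool → ℤ := fun a b => if a && b then -1 else 1
  have hs : ∀ a b, s a b = 1 ∨ s a b = -1 := by decide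
  have := hasMH_of_fintype (ι := Bool × Fin n) (fun i j => s i.1 j.1 * H i.2 j.2) ?_ ?_
  · simpa using this
  · intro i j
    rcases hs i.1 j.1 with h | h <;> rcases hH.1 i.2 j.2 with h' | h' <;> simp [h, h']
  · rintro ⟨a, i⟩ ⟨b, j⟩ hij
    have key : ∑ k : Bool × Fin n, s a k.1 * H i k.2 * (s b k.1 * H j k.2)
        = (∑ c, s a c * s b c) * ∑ k, H i k * H j k := by
      rw [Fintype.sum_prod_type, Finset.sum_mul_sum]
      exact Finset.sum_congr rfl fun c _ => Finset.sum_congr rfl fun k _ => by ring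
    simp only [key]
    rcases eq_or_ne a b with rfl | hab
    · rw [Int.cast_mul, IsModularHadamard.sum_eq_zero hH (fun h => hij (by rw [h])), mul_zero]
    · have hs0 : ∀ a b, a ≠ b → ∑ c, s a c * s b c = 0 := by decide
      rw [hs0 a b hab, zero_mul, Int.cast_zero]

/-- The witness is the all-ones matrix. -/
theorem hasMH_of_eq_zero {n : ℕ} (h : (n : ZMod 7) = 0) : HasMH n := by
  have := hasMH_of_fintype (ι := Fin n) (fun _ _ => 1) (fun _ _ => .inl rfl)
    (fun i j _ => by simpa using h)
  simpa using this

/-- The witness is `J - 2 I`, whose Gram matrix is `4 I + (n - 4) J`. -/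
theorem hasMH_of_eq_four {n : ℕ} (h : (n : ZMod 7) = 4) : HasMH n := by
  have := hasMH_of_fintype (ι := Fin n) (fun i j => if i = j then -1 else 1)
    (fun i j => by by_cases h : i = j <;> simp [h]) ?_
  · simpa using this
  · intro i j hij
    have key : ∀ k : Fin n, (if i = k then (-1 : ℤ) else 1) * (if j = k then -1 else 1)
        = 1 - 2 * (if i = k then 1 else 0) - 2 * (if j = k then 1 else 0) := fun k => by
      by_cases h1 : i = k <;> by_cases h2 : j = k
      · exact absurd (h1.trans h2.symm) hij
      all_goals simp [h1, h2]
    simp only [key, Finset.sum_sub_distrib, ← Finset.mul_sum, Finset.sum_ite_eq]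
    simp [h]
    decide

/-- Comparing determinants in `H Hᵀ = n I` over `ZMod 7` exhibits the odd power `nⁿ` as a square. -/
theorem isSquare_of_hasMH {n : ℕ} (h : HasMH n) (hn : ¬ Even n) : IsSquare (n : ZMod 7) := by
  have : Fact (Nat.Prime 7) := ⟨by norm_num⟩
  obtain ⟨H, -, hH⟩ := h
  let A : Matrix (Fin n) (Fin n) (ZMod 7) := H.map (Int.castRingHom (ZMod 7))
  have hA : A * A.transpose = (n : ZMod 7) • (1 : Matrix (Fin n) (Fin n) (ZMod 7)) := by
    ext i j
    have := (ZMod.intCast_eq_intCast_iff _ _ 7).2 (hH i j)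
    rw [Matrix.mul_apply] at this ⊢
    simpa [A, Matrix.one_apply] using this
  have hdet := congrArg Matrix.det hA
  rw [Matrix.det_mul, Matrix.det_transpose, Matrix.det_smul, Matrix.det_one, Fintype.card_fin,
    mul_one] at hdet
  obtain ⟨m, hm⟩ := Nat.not_even_iff_odd.1 hn
  rcases eq_or_ne (n : ZMod 7) 0 with h0 | h0
  · rw [h0]; exact ⟨0, by simp⟩
  · have hp : ∀ x : ZMod 7, x ^ n = x ^ m * x ^ m * x := fun x => by rw [hm]; ring
    refine ⟨A.det / (n : ZMod 7) ^ m, ?_⟩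
    rw [hp] at hdet
    rw [div_mul_div_comm, hdet]
    field_simp

/-! ### Gluing blocks -/

/-- A symmetric design modulo `7`: a `0`-`1` matrix `d` of order `v` whose row sums are `κ` and whose
inner products of distinct rows are `l`, modulo `7`. Rows and columns are numbered by the natural
numbers below `v`, so that blocks of different orders have a common index type; the values of `d`
elsewhere play no role in the congruences. -/
structure Pattern where
  v : ℕ
  d : ℕ → ℕ → ℤ
  κ : ℤ
  l : ℤ
  zero_or_one : ∀ x y, d x y = 0 ∨ d x y = 1
  row : ∀ x < v, ((∑ z ∈ Finset.range v, d x z : ℤ) : ZMod 7) = κ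
  pair : ∀ x < v, ∀ y < v, x ≠ y → ((∑ z ∈ Finset.range v, d x z * d y z : ℤ) : ZMod 7) = l

/-- The matrix whose block in classes `a`, `c` is `S a c • (J - 2 A)`, where `A` is `e a c • I` for
`c ≠ a` and `e a a • I` plus the matrix of the pattern `D a` for `c = a`. A class may carry a nonzero
pattern only if no identity block ends in it (`hed`), and identity blocks join classes of equal size
(`hev`). The hypothesis `hk` expresses orthogonality of two rows of the same class. For rows
`x`, `y` of distinct classes `a`, `b`, the hypotheses `hZ` and `hV` say that the part of the inner
product independent of `x`, `y`, and the part which occurs only for `x = y`, vanish. -/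
theorem hasMH_of_blocks {C : Type*} [Fintype C] [DecidableEq C] (D : C → Pattern) (S e : C → C → ℤ)
    (k : ZMod 7)
    (hS : ∀ a b, S a b = 1 ∨ S a b = -1) (he : ∀ a b, e a b = 0 ∨ e a b = 1)
    (hev : ∀ a b, e a b ≠ 0 → (D a).v = (D b).v)
    (hed : ∀ a b, e a b ≠ 0 → (D b).d = 0)
    (hk : ∀ a, ((∑ b, e a b : ℤ) : ZMod 7) + (D a).κ - (D a).l = k)
    (hn : ((∑ a, (D a).v : ℕ) : ZMod 7) = 4 * k)
    (hZ : ∀ a b, a ≠ b → ((∑ c, S a c * S b c * ((D c).v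
      - 2 * (e a c + if c = a then (D a).κ else 0)
      - 2 * (e b c + if c = b then (D b).κ else 0)) : ℤ) : ZMod 7) = 0)
    (hV : ∀ a b, a ≠ b → ((∑ c, S a c * S b c * (e a c * e b c) : ℤ) : ZMod 7) = 0) :
    HasMH (∑ a, (D a).v) := by
  -- the `0`-`1` matrix of the sign changes in block `(a, c)`
  let A : C → C → ℕ → ℕ → ℤ := fun a c x z =>
    (if x = z then e a c else 0) + if c = a then (D a).d x z else 0
  have hA : ∀ a c x z, A a c x z = 0 ∨ A a c x z = 1 := by
    intro a c x z
    simp only [A]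
    by_cases hca : c = a
    · subst hca
      rcases he c c with h | h
      · simpa [h] using (D c).zero_or_one x z
      · by_cases hxz : x = z <;> simp [h, hed c c (by simp [h]), hxz]
    · by_cases hxz : x = z <;> simp [hca, hxz, he]
  have hrow : ∀ a c, ∀ x < (D a).v, ((∑ z : Fin (D c).v, A a c x z : ℤ) : ZMod 7)
      = ((e a c + if c = a then (D a).κ else 0 : ℤ) : ZMod 7) := by
    intro a c x hx
    rw [Fin.sum_univ_eq_sum_range (fun z => A a c x z) (D c).v]
    simp only [A, Finset.sum_add_distrib, Int.cast_add]
    congr 1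
    · rw [Finset.sum_ite_eq]
      split_ifs with h
      · rfl
      · by_contra h0
        refine h (Finset.mem_range.2 ?_)
        rw [← hev a c (fun h1 => h0 (by simp [h1]))]
        exact hx
    · by_cases hca : c = a
      · subst hca
        simpa using (D c).row x hx
      · simp [hca]
  -- an identity block and a pattern never meet in one column class, so the mixed terms vanish
  have hprod : ∀ a b c x y z, A a c x z * A b c y z =
      (if x = z then (if x = y then e a c * e b c else 0) else 0)
      + (if c = a then (if c = b then (D a).d x z * (D b).d y z else 0) else 0) := by
    intro a b c x y z
    simp only [A]
    have h1 : ∀ (a b : C) (w z : ℕ), e a b * (D b).d w z = 0 := fun a b w z => by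
      by_cases h : e a b = 0
      · simp [h]
      · simp [hed a b h]
    have h2 : ∀ (a b : C) (w z : ℕ), (D b).d w z * e a b = 0 := fun a b w z => by
      rw [mul_comm, h1]
    by_cases hxz : x = z
    · subst hxz
      by_cases hyx : y = x
      · subst hyx
        by_cases hca : c = a
        · subst hca
          by_cases hcb : c = b
          · subst hcb; simp [add_mul, mul_add, h1, h2]
          · simp [hcb, add_mul, h2]
        · by_cases hcb : c = b
          · subst hcb; simp [hca, mul_add, h1]
          · simp [hca, hcb]
      · by_cases hca : c = a
        · subst hca
          by_cases hcb : c = b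
          · subst hcb; simp [add_mul, h1, hyx, Ne.symm hyx]
          · simp [hcb, hyx, Ne.symm hyx]
        · by_cases hcb : c = b
          · subst hcb; simp [hca, h1, hyx, Ne.symm hyx]
          · simp [hca, hcb, hyx, Ne.symm hyx]
    · by_cases hyz : y = z
      · subst hyz
        by_cases hca : c = a
        · subst hca
          by_cases hcb : c = b
          · subst hcb; simp [mul_add, h2, hxz]
          · simp [hcb, hxz, h2]
        · by_cases hcb : c = b
          · subst hcb; simp [hca, hxz]
          · simp [hca, hcb, hxz]
      · by_cases hca : c = a
        · by_cases hcb : c = b <;> simp [hca, hxz, hyz]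
        · simp [hca, hxz]
  let H : (Σ a, Fin (D a).v) → (Σ a, Fin (D a).v) → ℤ :=
    fun i j => S i.1 j.1 * (1 - 2 * A i.1 j.1 i.2 j.2)
  have := hasMH_of_fintype H ?_ ?_
  · simpa using this
  · rintro ⟨a, x⟩ ⟨b, y⟩
    simp only [H]
    rcases hS a b with h | h <;> rcases hA a b x y with h' | h' <;> simp [h, h']
  · rintro ⟨a, x⟩ ⟨b, y⟩ hne
    have hexp : (((∑ j, H ⟨a, x⟩ j * H ⟨b, y⟩ j : ℤ)) : ZMod 7) =
        ((∑ c, S a c * S b c * ((D c).v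
      - 2 * (e a c + if c = a then (D a).κ else 0)
      - 2 * (e b c + if c = b then (D b).κ else 0)) : ℤ) : ZMod 7) +
        4 * ((∑ c, S a c * S b c * ∑ z : Fin (D c).v, A a c x z * A b c y z : ℤ) : ZMod 7) := by
      rw [Fintype.sum_sigma]
      push_cast
      rw [Finset.mul_sum, ← Finset.sum_add_distrib]
      refine Finset.sum_congr rfl fun c _ => ?_
      have r1 := hrow a c x x.2
      have r2 := hrow b c y y.2
      push_cast at r1 r2
      rw [← r1, ← r2]
      have : ∀ z : Fin (D c).v, ((H ⟨a, x⟩ ⟨c, z⟩ : ZMod 7)) * (H ⟨b, y⟩ ⟨c, z⟩ : ZMod 7)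
          = (S a c * S b c : ZMod 7) * (1 - 2 * (A a c x z : ZMod 7) - 2 * (A b c y z : ZMod 7)
            + 4 * ((A a c x z : ZMod 7) * (A b c y z : ZMod 7))) := fun z => by
        simp only [H]; push_cast; ring
      simp only [this, ← Finset.mul_sum, Finset.sum_add_distrib, Finset.sum_sub_distrib]
      simp only [Finset.sum_const, Finset.card_univ, Fintype.card_fin, nsmul_eq_mul, mul_one]
      ring
    rw [hexp]
    by_cases hab : a = b
    · subst hab
      have hxy : (x : ℕ) ≠ y := fun h => hne (by rw [Fin.ext h])
      have hsq : ∀ c, S a c * S a c = 1 := fun c => by rcases hS a c with h | h <;> simp [h]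
      have hp : ((∑ c, S a c * S a c * ∑ z : Fin (D c).v, A a c x z * A a c y z : ℤ) : ZMod 7)
          = (D a).l := by
        rw [← (D a).pair x x.2 y y.2 hxy]
        congr 1
        simp only [hsq, one_mul, hprod, hxy, if_false, ite_self, zero_add]
        rw [Finset.sum_eq_single a]
        · simp [Fin.sum_univ_eq_sum_range (fun z => (D a).d x z * (D a).d y z) (D a).v]
        · intro c _ hc; simp [hc]
        · simp
      rw [hp]
      simp only [hsq, one_mul, Finset.sum_sub_distrib, ← Finset.mul_sum, Finset.sum_add_distrib,
        Finset.sum_ite_eq', Finset.mem_univ, if_true]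
      have := hk a
      push_cast at this hn ⊢
      rw [hn, ← this]
      ring
    · rw [hZ a b hab, zero_add]
      have : (∑ c, S a c * S b c * ∑ z : Fin (D c).v, A a c x z * A b c y z)
          = if (x : ℕ) = y then ∑ c, S a c * S b c * (e a c * e b c) else 0 := by
        have h0 : ∀ c (z : ℕ), (if c = a then (if c = b then (D a).d x z * (D b).d y z else 0)
            else 0) = 0 := fun c z => by
          by_cases h : c = a
          · subst h; simp [hab]
          · simp [h]
        simp only [hprod, h0, add_zero]
        by_cases hxy : (x : ℕ) = y
        · simp only [hxy, if_true]
          refine Finset.sum_congr rfl fun c _ => ?_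
          congr 1
          rw [Fin.sum_univ_eq_sum_range (fun z => if (y : ℕ) = z then e a c * e b c else 0)
            (D c).v, Finset.sum_ite_eq]
          split_ifs with h
          · rfl
          · by_contra h0
            refine h (Finset.mem_range.2 ?_)
            rw [← hev b c (fun h1 => h0 (by simp [h1]))]
            exact y.2
        · simp [hxy]
      rw [this]
      split_ifs
      · rw [hV a b hab, mul_zero]
      · simp

/-! ### Symmetric designs modulo seven -/

/-- The zero matrix of order `m`, the pattern of a free class. -/
def Pattern.zero (m : ℕ) : Pattern where
  v := m
  d := 0
  κ := 0
  l := 0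
  zero_or_one _ _ := .inl rfl
  row := by simp
  pair := by simp

/-- The zero matrix of order `1`. The condition on distinct rows is vacuous, so `l` is arbitrary;
`-k` is the value for which `κ - l = k`. -/
def Pattern.point (k : ℤ) : Pattern where
  v := 1
  d := 0
  κ := 0
  l := -k
  zero_or_one _ _ := .inl rfl
  row := by simp
  pair x hx y hy hxy := by omega

/-- The pattern of a Boolean matrix, with its congruences in decidable form. -/
def Pattern.ofBool (v : ℕ) (f : ℕ → ℕ → Bool) (κ l : ℤ)
    (hrow : ∀ x < v, (∑ z ∈ Finset.range v, (f x z).toInt - κ) % 7 = 0)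
    (hpair : ∀ x < v, ∀ y < v, x ≠ y →
      (∑ z ∈ Finset.range v, (f x z && f y z).toInt - l) % 7 = 0) : Pattern where
  v := v
  d x z := (f x z).toInt
  κ := κ
  l := l
  zero_or_one x y := by cases f x y <;> simp
  row x hx := by
    rw [ZMod.intCast_eq_intCast_iff_dvd_sub, ← Int.dvd_neg, neg_sub]
    exact Int.dvd_of_emod_eq_zero (hrow x hx)
  pair x hx y hy hxy := by
    have h : ∀ z, (f x z).toInt * (f y z).toInt = (f x z && f y z).toInt := fun z => by
      cases f x z <;> cases f y z <;> rfl
    simp only [h]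
    rw [ZMod.intCast_eq_intCast_iff_dvd_sub, ← Int.dvd_neg, neg_sub]
    exact Int.dvd_of_emod_eq_zero (hpair x hx y hy hxy)

theorem sum_range_add_mod (v c : ℕ) (f : ℕ → ℤ) :
    ∑ z ∈ Finset.range v, f ((z + c) % v) = ∑ z ∈ Finset.range v, f z := by
  rcases Nat.eq_zero_or_pos v with rfl | hv
  · simp
  have : NeZero v := ⟨hv.ne'⟩
  rw [← Fin.sum_univ_eq_sum_range, ← Fin.sum_univ_eq_sum_range]
  refine Eq.trans ?_ (Equiv.sum_comp (Equiv.addRight (Fin.ofNat v c)) (fun z : Fin v => f z))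
  refine Finset.sum_congr rfl fun z _ => ?_
  simp [Fin.val_add]

/-- The cyclic translates of the subset `f` of `ℤ/v`, a difference set modulo `7`. -/
def Pattern.cyclic (v : ℕ) (f : ℕ → Bool) (κ l : ℤ)
    (hrow : (∑ z ∈ Finset.range v, (f z).toInt - κ) % 7 = 0)
    (hpair : ∀ t < v, 0 < t →
      (∑ z ∈ Finset.range v, (f z && f ((z + t) % v)).toInt - l) % 7 = 0) : Pattern :=
  Pattern.ofBool v (fun x z => f ((z + (v - x)) % v)) κ l
    (fun x _ => by rw [sum_range_add_mod v (v - x) (fun z => (f z).toInt)]; exact hrow)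
    (fun x hx y hy hxy => by
      have hv : 0 < v := by omega
      have key : ∀ z, (z + (v - y)) % v = ((z + (v - x)) % v + (x + (v - y)) % v) % v := by
        intro z
        rw [← Nat.add_mod, show z + (v - x) + (x + (v - y)) = z + (v - y) + v by omega,
          Nat.add_mod_right]
      rw [Finset.sum_congr rfl fun z _ => by rw [key z], sum_range_add_mod v (v - x)
        (fun u => (f u && f ((u + (x + (v - y)) % v) % v)).toInt)]
      refine hpair _ (Nat.mod_lt _ hv) (Nat.pos_of_ne_zero fun h => hxy ?_)
      obtain ⟨c, hc⟩ := Nat.dvd_of_mod_eq_zero h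
      have hc1 : c = 1 := by
        have h1 : 0 < c := by
          rcases Nat.eq_zero_or_pos c with rfl | h
          · omega
          · exact h
        have h2 : c < 2 := by
          by_contra h3
          have : v * 2 ≤ v * c := Nat.mul_le_mul_left v (by omega)
          omega
        omega
      subst hc1
      omega)

/-- The projective plane of order `3`, from a perfect difference set. -/
def plane3 : Pattern :=
  Pattern.cyclic 13 (fun t => t ∈ [0, 1, 3, 9]) 4 1 (by decide +kernel) (by decide +kernel)

/-- The projective plane of order `4`, from a perfect difference set. -/
def plane4 : Pattern :=
  Pattern.cyclic 21 (fun t => t ∈ [3, 6, 7, 12, 14]) 5 1 (by decide +kernel) (by decide +kernel)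

/-- The `(19, 9, 4)` design of the nonzero squares modulo `19`. -/
def paley19 : Pattern :=
  Pattern.cyclic 19 (fun t => t ^ 9 % 19 = 1) 9 4 (by decide +kernel) (by decide +kernel)

/-- The `(23, 11, 5)` design of the nonzero squares modulo `23`. -/
def paley23 : Pattern :=
  Pattern.cyclic 23 (fun t => t ^ 11 % 23 = 1) 11 5 (by decide +kernel) (by decide +kernel)

/-- The `(47, 23, 11)` design of the nonzero squares modulo `47`. Modulo `7` its parameters are
those of `paley19`, and the orders differ by `4` modulo `8`. -/
def paley47 : Pattern :=
  Pattern.cyclic 47 (fun t => t ^ 23 % 47 = 1) 23 11 (by decide +kernel) (by decide +kernel)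

/-- The `(107, 53, 26)` design of the nonzero squares modulo `107`. Modulo `7` its parameters are
those of `paley23`, and the orders differ by `4` modulo `8`. -/
def paley107 : Pattern :=
  Pattern.cyclic 107 (fun t => t ^ 53 % 107 = 1) 53 26 (by decide +kernel) (by decide +kernel)

/-- The `(36, 15, 6)` design formed by the adjacency matrix of the Latin square graph of `ℤ/6`: two
cells of the table are adjacent if they share the row, the column or the entry. -/
def latinSquare6 : Pattern :=
  Pattern.ofBool 36 (fun x z => x ≠ z ∧ (x / 6 = z / 6 ∨ x % 6 = z % 6 ∨
    (x / 6 + x % 6) % 6 = (z / 6 + z % 6) % 6)) 15 6 (by decide +kernel) (by decide +kernel)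

/-- A `(25, 9, 3)` design. Binary digit `z` of entry `x` of the list is the entry in row `x` and column
`z`; it has an automorphism of order `3` that fixes the first point and the first block. -/
def design25 : Pattern :=
  Pattern.ofBool 25 (fun x z => Nat.testBit (
    [1022, 14787120, 25845984, 22331728, 8000068, 12321944, 20515106, 4770860, 9484362,
    18904086, 13713543, 27427085, 21766667, 897412, 1271560, 2542210, 12981538, 25497156,
    21174424, 6303169, 8936209, 17864353, 754771, 1452085, 2445417].getD x 0) z) 9 3
    (by decide +kernel) (by decide +kernel)

/-! ### Schemes with free classes -/

/-- The sign matrix encoded by a list of numbers: entry `(i, j)` is `-1` if binary digit `j` of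
the `i`-th number is `1`. -/
def signOf (rows : List ℕ) (i j : ℕ) : ℤ := if (rows.getD i 0).testBit j then -1 else 1

/-- The coefficient of the identity matrix in block `(a, c)`. The free classes are `Sum.inl i`; between
free classes `i` and `j` it is given by the Boolean function `p` of the bitwise exclusive or of `i`
and `j`, as in the orthogonal designs from quaternions and octonions. -/
def flipWeight {r q : ℕ} (p : ℕ → Bool) : Fin r ⊕ Fin q → Fin r ⊕ Fin q → ℤ
  | .inl i, .inl j => (p (i ^^^ j)).toInt
  | _, _ => 0

/-- The number of a class in the sign table: the free classes come first. -/
def blockIndex {r q : ℕ} : Fin r ⊕ Fin q → ℕ :=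
  Sum.elim (fun i => i) (fun j => r + j)

/-- The finite conditions on a sign table `S` for `r` free classes of a size congruent to `σ` and
fixed classes carrying the patterns `D`, with total size congruent to `4 k` modulo `7`. The fields
`weight` and `order` give orthogonality within a class, `distinct` and `weighing` between distinct
classes; `weight` and `weighing` together say that the identity coefficients, with the signs of `S`, form
a weighing matrix of weight `k` modulo `7`. -/
structure IsScheme (r : ℕ) {q : ℕ} (k σ : ℤ) (p : ℕ → Bool) (D : Fin q → Pattern)
    (S : Fin r ⊕ Fin q → Fin r ⊕ Fin q → ℤ) : Prop where
  weight : ∀ i : Fin r, (∑ j : Fin r, (p (i ^^^ j)).toInt - k) % 7 = 0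
  order : ∀ j, ((D j).κ - (D j).l - k) % 7 = 0
  size : (r * σ + ∑ j, ((D j).v : ℤ) - 4 * k) % 7 = 0
  distinct : ∀ a b, a ≠ b → (∑ c, S a c * S b c * (Sum.elim (fun _ => σ) (fun j => ((D j).v : ℤ)) c
    - 2 * (flipWeight p a c + if c = a then Sum.elim (fun _ => 0) (fun j => (D j).κ) a else 0)
    - 2 * (flipWeight p b c + if c = b then Sum.elim (fun _ => 0) (fun j => (D j).κ) b else 0))) % 7
      = 0
  weighing : ∀ a b, a ≠ b →
    (∑ c, S a c * S b c * (flipWeight p a c * flipWeight p b c)) % 7 = 0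

instance (r q : ℕ) (k σ : ℤ) (p : ℕ → Bool) (D : Fin q → Pattern)
    (S : Fin r ⊕ Fin q → Fin r ⊕ Fin q → ℤ) : Decidable (IsScheme r k σ p D S) :=
  decidable_of_iff (_ ∧ _ ∧ _ ∧ _ ∧ _)
    ⟨fun ⟨h1, h2, h3, h4, h5⟩ => ⟨h1, h2, h3, h4, h5⟩,
      fun ⟨h1, h2, h3, h4, h5⟩ => ⟨h1, h2, h3, h4, h5⟩⟩

theorem intCast_eq_zero_of_emod {a : ℤ} (h : a % 7 = 0) : (a : ZMod 7) = 0 :=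
  (ZMod.intCast_zmod_eq_zero_iff_dvd a 7).2 (Int.dvd_of_emod_eq_zero h)

/-- A scheme yields modular Hadamard matrices for all values of the free size in its residue class. -/
theorem IsScheme.hasMH {r q : ℕ} {k σ : ℤ} {p : ℕ → Bool} {D : Fin q → Pattern} {rows : List ℕ}
    (h : IsScheme r k σ p D fun a b => signOf rows (blockIndex a) (blockIndex b))
    {m : ℕ} (hm : (m : ZMod 7) = σ) : HasMH (r * m + ∑ j, (D j).v) := by
  let E : Fin r ⊕ Fin q → Pattern := Sum.elim (fun _ => Pattern.zero m) D
  have hv : ∀ c, (((E c).v : ℤ) : ZMod 7)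
      = ((Sum.elim (fun _ => σ) (fun j => ((D j).v : ℤ)) c : ℤ) : ZMod 7) := by
    rintro (i | j)
    · simpa [E, Pattern.zero] using hm
    · simp [E]
  have hκ : ∀ c, (E c).κ = Sum.elim (fun _ => 0) (fun j => (D j).κ) c := by
    rintro (i | j) <;> rfl
  have hw : ∀ a b : Fin r ⊕ Fin q, flipWeight p a b = 0 ∨ flipWeight p a b = 1 := by
    rintro (i | i) (j | j)
    · simp only [flipWeight]
      cases p (i ^^^ j) <;> simp
    all_goals exact .inl rfl
  have hinl : ∀ a b : Fin r ⊕ Fin q, flipWeight p a b ≠ 0 →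
      (∃ i, a = .inl i) ∧ ∃ j, b = .inl j := by
    rintro (i | i) (j | j) h
    · exact ⟨⟨i, rfl⟩, j, rfl⟩
    all_goals exact absurd rfl h
  have := hasMH_of_blocks E (fun a b => signOf rows (blockIndex a) (blockIndex b))
    (flipWeight p) k ?_ hw ?_ ?_ ?_ ?_ ?_ ?_
  · simpa [E, Pattern.zero] using this
  · intro a b
    unfold signOf
    split_ifs <;> simp
  · intro a b hab
    obtain ⟨⟨i, rfl⟩, j, rfl⟩ := hinl a b hab
    rfl
  · intro a b hab
    obtain ⟨-, j, rfl⟩ := hinl a b hab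
    rfl
  · rintro (i | j)
    · have := intCast_eq_zero_of_emod (h.weight i)
      simpa [E, Pattern.zero, flipWeight, sub_eq_zero] using this
    · have := intCast_eq_zero_of_emod (h.order j)
      simpa [E, flipWeight, sub_eq_zero] using this
  · have := intCast_eq_zero_of_emod h.size
    push_cast at this
    rw [sub_eq_zero] at this
    simpa [E, Pattern.zero, hm] using this
  · intro a b hab
    rw [← intCast_eq_zero_of_emod (h.distinct a b hab)]
    push_cast
    refine Finset.sum_congr rfl fun c _ => ?_
    have := hv c
    push_cast at this
    rw [this, hκ, hκ]
  · exact fun a b hab => intCast_eq_zero_of_emod (h.weighing a b hab)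

/-! ### The schemes -/

theorem hasMH_two_mul_add_37 {m : ℕ} (hm : (m : ZMod 7) = 3) : HasMH (2 * m + 37) := by
  have h : IsScheme 2 2 3 (fun _ => true) ![.point 2, latinSquare6]
    fun a b => signOf [0, 5, 3, 1] (blockIndex a) (blockIndex b) := by decide +kernel
  exact h.hasMH hm

theorem hasMH_four_mul_add_21 {m : ℕ} (hm : (m : ZMod 7) = 4) : HasMH (4 * m + 21) := by
  have h : IsScheme 4 4 4 (fun _ => true) ![plane4]
    fun a b => signOf [0, 3, 5, 9, 14] (blockIndex a) (blockIndex b) := by decide +kernel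
  exact h.hasMH hm

theorem hasMH_four_mul_add_63 {m : ℕ} (hm : (m : ZMod 7) = 4) : HasMH (4 * m + 63) := by
  have h : IsScheme 4 4 4 (fun _ => true) ![plane4, plane4, plane4]
    fun a b => signOf [0, 19, 37, 57, 11, 29, 62] (blockIndex a) (blockIndex b) := by decide +kernel
  exact h.hasMH hm

theorem hasMH_four_mul {m : ℕ} (hm : (m : ZMod 7) = 3) : HasMH (4 * m) := by
  have h : IsScheme 4 3 3 (fun t => t ≠ 0) ![]
    fun a b => signOf [0, 5, 9, 3] (blockIndex a) (blockIndex b) := by decide +kernel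
  exact h.hasMH hm

theorem hasMH_four_mul_add_14 {m : ℕ} (hm : (m : ZMod 7) = 3) : HasMH (4 * m + 14) := by
  have h : IsScheme 4 3 3 (fun t => t ≠ 0) ![.point 3, plane3]
    fun a b => signOf [0, 5, 6, 20, 28, 27] (blockIndex a) (blockIndex b) := by decide +kernel
  exact h.hasMH hm

theorem hasMH_eight_mul_add_38_and_66 {m : ℕ} (hm : (m : ZMod 7) = 3) :
    HasMH (8 * m + 38) ∧ HasMH (8 * m + 66) := by
  have h : ∀ b, IsScheme 8 5 3 (fun t => t < 5) ![paley19, bif b then paley47 else paley19]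
    fun a b => signOf [0, 51, 85, 153, 271, 316, 346, 406, 273, 225] (blockIndex a)
      (blockIndex b) := by decide +kernel
  exact ⟨(h false).hasMH hm, (h true).hasMH hm⟩

theorem hasMH_eight_mul_add_98_and_182 {m : ℕ} (hm : (m : ZMod 7) = 3) :
    HasMH (8 * m + 98) ∧ HasMH (8 * m + 182) := by
  have h : ∀ b, IsScheme 8 6 3 (fun t => t < 6)
    ![.point 6, .point 6, paley23, bif b then paley107 else paley23, design25, design25]
    fun a b => signOf [0, 5461, 51, 5478, 816, 5733, 240, 5541, 828, 5737, 2405, 5071, 2096, 3738]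
      (blockIndex a) (blockIndex b) := by decide +kernel
  exact ⟨(h false).hasMH hm, (h true).hasMH hm⟩

/-! ### Residue classes modulo seven -/

/-- Solves `r m + c = n` for the free size `m` in a prescribed residue class modulo `7`. -/
theorem exists_free_size {n r c s : ℕ} (hn : r * s + c ≤ n)
    (h : n % (7 * r) = (r * s + c) % (7 * r)) : ∃ m : ℕ, (m : ZMod 7) = s ∧ n = r * m + c := by
  obtain ⟨t, ht⟩ := (Nat.modEq_iff_dvd' hn).1 (Nat.ModEq.symm h)
  refine ⟨s + 7 * t, ?_, ?_⟩
  · push_cast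
    rw [show (7 : ZMod 7) = 0 from rfl, zero_mul, add_zero]
  · have : n = r * s + c + 7 * r * t := by omega
    rw [this]
    ring

theorem hasMH_of_mod_one {n : ℕ} (hn : 1000 ≤ n) (h : n % 7 = 1) : HasMH n := by
  rcases Nat.even_or_odd' n with ⟨m, rfl | hm⟩
  · have h4 : (m : ZMod 7) = (4 : ℕ) := (ZMod.natCast_eq_natCast_iff' _ _ _).2 (by omega)
    exact (hasMH_of_eq_four h4).two_mul
  · obtain ⟨m, hs, rfl⟩ := exists_free_size (n := n) (r := 2) (c := 37) (s := 3)
      (by omega) (by omega)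
    exact hasMH_two_mul_add_37 hs

theorem hasMH_of_mod_two {n : ℕ} (hn : 2000 ≤ n) (h : n % 7 = 2) : HasMH n := by
  have : n % 4 = 1 ∨ n % 4 = 3 ∨ n % 2 = 0 := by omega
  rcases this with h4 | h4 | h2
  · obtain ⟨m, hs, rfl⟩ := exists_free_size (n := n) (r := 4) (c := 21) (s := 4)
      (by omega) (by omega)
    exact hasMH_four_mul_add_21 hs
  · obtain ⟨m, hs, rfl⟩ := exists_free_size (n := n) (r := 4) (c := 63) (s := 4)
      (by omega) (by omega)
    exact hasMH_four_mul_add_63 hs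
  · obtain ⟨m, rfl⟩ := Nat.dvd_of_mod_eq_zero h2
    exact (hasMH_of_mod_one (by omega) (by omega)).two_mul

theorem hasMH_of_even_of_mod_five {n : ℕ} (hn : 1000 ≤ n) (h2 : n % 2 = 0) (h : n % 7 = 5) :
    HasMH n := by
  have : n % 4 = 0 ∨ n % 4 = 2 := by omega
  rcases this with h4 | h4
  · obtain ⟨m, hs, rfl⟩ := exists_free_size (n := n) (r := 4) (c := 0) (s := 3)
      (by omega) (by omega)
    exact hasMH_four_mul hs
  · obtain ⟨m, hs, rfl⟩ := exists_free_size (n := n) (r := 4) (c := 14) (s := 3)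
      (by omega) (by omega)
    exact hasMH_four_mul_add_14 hs

theorem hasMH_of_even_of_mod_three {n : ℕ} (hn : 2000 ≤ n) (h2 : n % 2 = 0) (h : n % 7 = 3) :
    HasMH n := by
  have : n % 8 = 2 ∨ n % 8 = 6 ∨ n % 4 = 0 := by omega
  rcases this with h8 | h8 | h4
  · obtain ⟨m, hs, rfl⟩ := exists_free_size (n := n) (r := 8) (c := 98) (s := 3)
      (by omega) (by omega)
    exact (hasMH_eight_mul_add_98_and_182 hs).1
  · obtain ⟨m, hs, rfl⟩ := exists_free_size (n := n) (r := 8) (c := 182) (s := 3)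
      (by omega) (by omega)
    exact (hasMH_eight_mul_add_98_and_182 hs).2
  · obtain ⟨m, rfl⟩ : 2 ∣ n := by omega
    exact (hasMH_of_even_of_mod_five (by omega) (by omega) (by omega)).two_mul

theorem hasMH_of_even_of_mod_six {n : ℕ} (hn : 4000 ≤ n) (h2 : n % 2 = 0) (h : n % 7 = 6) :
    HasMH n := by
  have : n % 8 = 6 ∨ n % 8 = 2 ∨ n % 4 = 0 := by omega
  rcases this with h8 | h8 | h4
  · obtain ⟨m, hs, rfl⟩ := exists_free_size (n := n) (r := 8) (c := 38) (s := 3)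
      (by omega) (by omega)
    exact (hasMH_eight_mul_add_38_and_66 hs).1
  · obtain ⟨m, hs, rfl⟩ := exists_free_size (n := n) (r := 8) (c := 66) (s := 3)
      (by omega) (by omega)
    exact (hasMH_eight_mul_add_38_and_66 hs).2
  · obtain ⟨m, rfl⟩ : 2 ∣ n := by omega
    exact (hasMH_of_even_of_mod_three (by omega) (by omega) (by omega)).two_mul

/-- The Hadamard conjecture modulo `7` for `n ≥ 4.5 × 10 ^ 36`: an `MH(n, 7)` exists if and only if
`n` is even or a square modulo `7` (the class of `0` included). -/
theorem mainTheorem1 (n : ℕ) (hn : 45 * 10 ^ 35 ≤ n) :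
    (∃ H : Matrix (Fin n) (Fin n) ℤ, IsModularHadamard n 7 H) ↔
      (Even n ∨ IsSquare (n : ZMod 7)) := by
  refine ⟨fun h => or_iff_not_imp_left.2 (isSquare_of_hasMH h), fun h => ?_⟩
  have hcast : ∀ a : ℕ, n % 7 = a % 7 → (n : ZMod 7) = a := fun a =>
    (ZMod.natCast_eq_natCast_iff' n a 7).2
  -- `3`, `5` and `6` are not squares modulo `7`, so `n` is even in these classes
  have heven : ∀ a : ℕ, ¬ IsSquare (a : ZMod 7) → n % 7 = a % 7 → n % 2 = 0 := fun a ha hna =>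
    Nat.even_iff.1 (h.resolve_right (by rwa [hcast a hna]))
  have : n % 7 = 0 ∨ n % 7 = 1 ∨ n % 7 = 2 ∨ n % 7 = 3 ∨ n % 7 = 4 ∨ n % 7 = 5 ∨ n % 7 = 6 := by
    omega
  rcases this with h7 | h7 | h7 | h7 | h7 | h7 | h7
  · exact hasMH_of_eq_zero (by simpa using hcast 0 h7)
  · exact hasMH_of_mod_one (by omega) h7
  · exact hasMH_of_mod_two (by omega) h7
  · exact hasMH_of_even_of_mod_three (by omega) (heven 3 (by decide) h7) h7
  · exact hasMH_of_eq_four (hcast 4 h7)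
  · exact hasMH_of_even_of_mod_five (by omega) (heven 5 (by decide) h7) h7
  · exact hasMH_of_even_of_mod_six (by omega) (heven 6 (by decide) h7) h7
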